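/- Let $\Bbbk$ be a field of characteristic $0$, let $n\in\mathbb Z$, and let $\mathfrak g=\bigoplus_{i\in\mathbb Z}\mathfrak g^i$ be a finite-dimensional graded $\Bbbk$-vector space; write $V[k]^i=V^{i+k}$ for shifts. For a finite-dimensional graded space $W$ let $\hat S W=\prod_{k\ge0}S^kW$ be the complete graded symmetric algebra and $\hat S_{\ge 2}W=\prod_{k\ge2}S^kW$. Let $\overline{\mathrm{Der}}\,\hat S\mathfrak g^*[-1]$ be the graded Lie algebra of continuous derivations of $\hat S\mathfrak g^*[-1]$ without constant term, with the graded commutator $[Q,R]=QR-(-1)^{|Q||R|}RQ$. Let $L=\big(\hat S(\mathfrak g^*[-1]\oplus\mathfrak g[1-n])\big)[n]$, with the graded Lie bracket $\{-,-\}$ given by the $n$-shifted Poisson bracket: the continuous biderivation of degree $-n$ on $\hat S(\mathfrak g^*[-1]\oplus\mathfrak g[1-n])$ with $\{w,x\}=(-1)^{n|x|}\langle x,w\rangle$ and $\{x,w\}=-(-1)^{|x|}\langle x,w\rangle$ for homogeneous $x\in\mathfrak g^*[-1]$, $w\in\mathfrak g[1-n]$, and with all other brackets of generators equal to $0$. Let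 $\mathfrak h=(\hat S_{\ge2}\mathfrak g[1-n])[n]\subset L$, let $P:L\to\mathfrak h$ be the natural projection, and put $\mathrm{ad}_r(y)=\{y,r\}$. Let $D_n:\overline{\mathrm{Der}}\,\hat S\mathfrak g^*[-1]\cong\hat S\mathfrak g^*[-1]\otimes\mathfrak g[1]\to L$ be the $n$-shifted double, $f\otimes w\mapsto(-1)^{n|f|}f\cdot w$, where the derivation $Q$ corresponds to $\sum_iQ(e^i)\otimes e_i$ for dual bases $(e_i)$ of $\mathfrak g$ and $(e^i)$ of $\mathfrak g^*$. Let $\mathcal L_{\mathrm{LHM}}(\mathfrak g)=\overline{\mathrm{Der}}\,\hat S\mathfrak g^*[-1]\oplus\mathfrak h[-1]$ be the $L_\infty$-algebra whose structure maps, as graded symmetric operations of degree $1$ on $\overline{\mathrm{Der}}\,\hat S\mathfrak g^*[-1][1]\oplus\mathfrak h$, are $$\check m_2(Q[1],R[1])=(-1)^{|Q|}[Q,R][1],\qquad \check m_k(Q[1],\theta_1,\dots,\theta_{k-1})=P\{\cdots\{\{D_n(Q),\theta_1\},\theta_2\},\cdots,\theta_{k-1}\}\quad(k\ge2)$$ for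 homogeneous $Q,R\in\overline{\mathrm{Der}}\,\hat S\mathfrak g^*[-1]$ and $\theta_i\in\mathfrak h$, all operations not obtained from these by permuting the arguments being zero. An element $\xi$ of degree $0$ of $\mathcal L_{\mathrm{LHM}}(\mathfrak g)[1]$ is a Maurer-Cartan element if $\sum_{k\ge1}\frac1{k!}\check m_k(\xi,\dots,\xi)$ converges to $0$ (in the topology given by the filtration by weight, i.e. by symmetric powers). Theorem. Let $m\in\overline{\mathrm{Der}}^1\hat S\mathfrak g^*[-1]$ be a derivation of degree $1$ and let $r\in\mathfrak h$. The following are equivalent. 1. The pair $(m,r)$ is a triangular $n$-shifted $L_\infty$-bialgebra structure on $\mathfrak g$: that is, $m$ is an $L_\infty$-structure on $\mathfrak g$ ($m\circ m=0$), and $r$ is an $n$-shifted $r_\infty$-matrix for $(\mathfrak g,m)$ ($r$ has degree $0$ in $\mathfrak h$, and $P(e^{\mathrm{ad}_r}D_n(m))=0$). 2. $(m[1],r)$ is a Maurer-Cartan element of $\mathcal L_{\mathrm{LHM}}(\mathfrak g)$. -/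

import Mathlib

open scoped DirectSum

noncomputable section

namespace TriangularLInfty

/-! ## Graded symmetric algebras

A space `W` with parity operator `τ` (`τ w = (-1)^|w| w` on homogeneous `w`). -/

section Sym

variable {𝕜 : Type*} [Field 𝕜] {W : Type*} [AddCommGroup W] [Module 𝕜 W]
  {V : Type*} [AddCommGroup V] [Module 𝕜 V]

/-- Graded commutativity `x y = (-1)^{|x||y|} y x` for vectors `x`, `y` of parities `i`, `j`. -/
inductive SymRel (τ : W →ₗ[𝕜] W) : TensorAlgebra 𝕜 W → TensorAlgebra 𝕜 W → Prop
  | comm (i j : ℕ) (x y : W) (hx : τ x = (-1 : 𝕜) ^ i • x) (hy : τ y = (-1 : 𝕜) ^ j • y) :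
      SymRel τ (TensorAlgebra.ι 𝕜 x * TensorAlgebra.ι 𝕜 y)
        ((-1 : 𝕜) ^ (i * j) • (TensorAlgebra.ι 𝕜 y * TensorAlgebra.ι 𝕜 x))

/-- The (uncompleted) graded symmetric algebra `S W`. -/
def Sym (τ : W →ₗ[𝕜] W) : Type _ := RingQuot (SymRel τ)

instance (τ : W →ₗ[𝕜] W) : Ring (Sym τ) := inferInstanceAs (Ring (RingQuot (SymRel τ)))

instance (τ : W →ₗ[𝕜] W) : Algebra 𝕜 (Sym τ) :=
  inferInstanceAs (Algebra 𝕜 (RingQuot (SymRel τ)))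

/-- The quotient map from the tensor algebra. -/
def Sym.mk (τ : W →ₗ[𝕜] W) : TensorAlgebra 𝕜 W →ₐ[𝕜] Sym τ := RingQuot.mkAlgHom 𝕜 (SymRel τ)

/-- The inclusion of the generators `W → S W`. -/
def gen (τ : W →ₗ[𝕜] W) : W →ₗ[𝕜] Sym τ :=
  (Sym.mk τ).toLinearMap ∘ₗ TensorAlgebra.ι 𝕜

theorem gen_comm (τ : W →ₗ[𝕜] W) (i j : ℕ) (x y : W) (hx : τ x = (-1 : 𝕜) ^ i • x)
    (hy : τ y = (-1 : 𝕜) ^ j • y) :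
    gen τ x * gen τ y = (-1 : 𝕜) ^ (i * j) • (gen τ y * gen τ x) := by
  have h : Sym.mk τ _ = Sym.mk τ _ := RingQuot.mkAlgHom_rel 𝕜 (SymRel.comm i j x y hx hy)
  simpa [gen] using h

/-- The universal property of `S W`. -/
def lift {A : Type*} [Semiring A] [Algebra 𝕜 A] (τ : W →ₗ[𝕜] W) (f : W →ₗ[𝕜] A)
    (hf : ∀ (i j : ℕ) (x y : W), τ x = (-1 : 𝕜) ^ i • x → τ y = (-1 : 𝕜) ^ j • y →
      f x * f y = (-1 : 𝕜) ^ (i * j) • (f y * f x)) : Sym τ →ₐ[𝕜] A :=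
  RingQuot.liftAlgHom 𝕜 ⟨TensorAlgebra.lift 𝕜 f, by
    rintro _ _ ⟨i, j, x, y, hx, hy⟩
    simpa using hf i j x y hx hy⟩

theorem lift_gen {A : Type*} [Semiring A] [Algebra 𝕜 A] (τ : W →ₗ[𝕜] W) (f : W →ₗ[𝕜] A)
    (hf : ∀ (i j : ℕ) (x y : W), τ x = (-1 : 𝕜) ^ i • x → τ y = (-1 : 𝕜) ^ j • y →
      f x * f y = (-1 : 𝕜) ^ (i * j) • (f y * f x)) (w : W) :
    lift τ f hf (gen τ w) = f w := by
  simp only [gen, LinearMap.comp_apply, AlgHom.toLinearMap_apply]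
  exact (RingQuot.liftAlgHom_mkAlgHom_apply 𝕜 _ _ _).trans (TensorAlgebra.lift_ι_apply f w)

/-- Functoriality of `S`: a parity preserving map `g : W → V` induces `S W → S V`. -/
def symMap (τ : W →ₗ[𝕜] W) (τ' : V →ₗ[𝕜] V) (g : W →ₗ[𝕜] V) (hg : g ∘ₗ τ = τ' ∘ₗ g) :
    Sym τ →ₐ[𝕜] Sym τ' :=
  lift τ (gen τ' ∘ₗ g) (by
    intro i j x y hx hy
    refine gen_comm τ' i j _ _ ?_ ?_
    · rw [← LinearMap.comp_apply, ← hg, LinearMap.comp_apply, hx, map_smul]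
    · rw [← LinearMap.comp_apply, ← hg, LinearMap.comp_apply, hy, map_smul])

theorem symMap_gen (τ : W →ₗ[𝕜] W) (τ' : V →ₗ[𝕜] V) (g : W →ₗ[𝕜] V) (hg : g ∘ₗ τ = τ' ∘ₗ g)
    (w : W) : symMap τ τ' g hg (gen τ w) = gen τ' (g w) := lift_gen _ _ _ _

/-- The component `S^k W`. -/
abbrev weight (τ : W →ₗ[𝕜] W) (k : ℕ) : Submodule 𝕜 (Sym τ) := LinearMap.range (gen τ) ^ k

theorem symMap_mem (τ : W →ₗ[𝕜] W) (τ' : V →ₗ[𝕜] V) (g : W →ₗ[𝕜] V) (hg : g ∘ₗ τ = τ' ∘ₗ g)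
    (k : ℕ) : ∀ s ∈ weight τ k, (symMap τ τ' g hg).toLinearMap s ∈ weight τ' k := by
  intro s hs
  have h : (weight τ k).map (symMap τ τ' g hg).toLinearMap ≤ weight τ' k := by
    rw [weight, Submodule.map_pow]
    refine pow_le_pow_left' ?_ k
    rintro _ ⟨_, ⟨w, rfl⟩, rfl⟩
    exact ⟨g w, (symMap_gen τ τ' g hg w).symm⟩
  exact h ⟨s, hs, rfl⟩

/-- The component of parity `p` of a covector: `φ_p = (φ + (-1)^p φ ∘ τ) / 2`. -/
def covParity (τ : W →ₗ[𝕜] W) (p : ℕ) (φ : Module.Dual 𝕜 W) : Module.Dual 𝕜 W :=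
  (2 : 𝕜)⁻¹ • (φ + (-1 : 𝕜) ^ p • (φ ∘ₗ τ))

theorem covParity_eq_zero_or (τ : W →ₗ[𝕜] W) (p i : ℕ) (φ : Module.Dual 𝕜 W) (x : W)
    (hx : τ x = (-1 : 𝕜) ^ i • x) : covParity τ p φ x = 0 ∨ (-1 : 𝕜) ^ p = (-1 : 𝕜) ^ i := by
  rcases neg_one_pow_eq_or 𝕜 p with hp | hp <;> rcases neg_one_pow_eq_or 𝕜 i with hi | hi <;>
    simp [covParity, hx, hp, hi]

theorem pow_parity (τ : W →ₗ[𝕜] W) (p i : ℕ) (x : W) (hx : τ x = (-1 : 𝕜) ^ i • x) :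
    (τ ^ p) x = (-1 : 𝕜) ^ (p * i) • x := by
  induction p with
  | zero => simp
  | succ p ih =>
    rw [pow_succ', Module.End.mul_apply, ih, map_smul, hx, smul_smul, ← pow_add]
    congr 2
    ring

/-- Auxiliary to `contr`: a generator `w` acts on `S W × S W` by the matrix with rows
`(τ^p w, φ_p w)` and `(0, w)`. -/
def contrAux (τ : W →ₗ[𝕜] W) (p : ℕ) (φ : Module.Dual 𝕜 W) :
    W →ₗ[𝕜] Module.End 𝕜 (Sym τ × Sym τ) where
  toFun w := LinearMap.prod
    (LinearMap.mulLeft 𝕜 (gen τ ((τ ^ p) w)) ∘ₗ LinearMap.fst 𝕜 _ _ +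
      covParity τ p φ w • LinearMap.snd 𝕜 _ _)
    (LinearMap.mulLeft 𝕜 (gen τ w) ∘ₗ LinearMap.snd 𝕜 _ _)
  map_add' a b := by
    ext x <;> simp [add_mul, add_smul]
  map_smul' a b := by
    ext x <;> simp [mul_smul]

theorem contrAux_apply (τ : W →ₗ[𝕜] W) (p : ℕ) (φ : Module.Dual 𝕜 W) (w : W)
    (a : Sym τ × Sym τ) :
    contrAux τ p φ w a =
      (gen τ ((τ ^ p) w) * a.1 + covParity τ p φ w • a.2, gen τ w * a.2) := rfl

theorem contrAux_comm (τ : W →ₗ[𝕜] W) (p : ℕ) (φ : Module.Dual 𝕜 W) (i j : ℕ) (x y : W)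
    (hx : τ x = (-1 : 𝕜) ^ i • x) (hy : τ y = (-1 : 𝕜) ^ j • y) :
    contrAux τ p φ x * contrAux τ p φ y =
      (-1 : 𝕜) ^ (i * j) • (contrAux τ p φ y * contrAux τ p φ x) := by
  have hc := gen_comm τ i j x y hx hy
  have hsq : ∀ k l : ℕ, (-1 : 𝕜) ^ (k * l) = ((-1 : 𝕜) ^ k) ^ l := fun k l => pow_mul _ _ _
  refine LinearMap.ext fun a => Prod.ext ?_ ?_
  · simp only [Module.End.mul_apply, contrAux_apply, LinearMap.smul_apply, Prod.smul_fst,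
      pow_parity τ p i x hx, pow_parity τ p j y hy, map_smul]
    have key : ∀ b : Sym τ, covParity τ p φ y • (((-1 : 𝕜) ^ (p * i)) • (gen τ x * b)) =
        (-1 : 𝕜) ^ (i * j) • (covParity τ p φ y • (gen τ x * b)) := by
      intro b
      rcases covParity_eq_zero_or τ p j φ y hy with h | h
      · simp [h]
      · rw [hsq p i, h, ← hsq, mul_comm j i, smul_comm]
    have key' : ∀ b : Sym τ, covParity τ p φ x • (gen τ y * b) = (-1 : 𝕜) ^ (i * j) •
        (covParity τ p φ x • (((-1 : 𝕜) ^ (p * j)) • (gen τ y * b))) := by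
      intro b
      rcases covParity_eq_zero_or τ p i φ x hx with h | h
      · simp [h]
      · rw [hsq p j, h, ← hsq, smul_comm, smul_smul ((-1 : 𝕜) ^ (i * j)), ← mul_pow]
        simp
    have hb : ∀ b : Sym τ, gen τ x * (gen τ y * b) =
        (-1 : 𝕜) ^ (i * j) • (gen τ y * (gen τ x * b)) := by
      intro b
      rw [← mul_assoc, hc, smul_mul_assoc, mul_assoc]
    simp only [mul_add, smul_mul_assoc, mul_smul_comm, smul_add, hb]
    rw [key, key' a.2, smul_comm ((-1 : 𝕜) ^ (p * j)) ((-1 : 𝕜) ^ (p * i)),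
      smul_comm ((-1 : 𝕜) ^ (p * j)) ((-1 : 𝕜) ^ (i * j)),
      smul_comm ((-1 : 𝕜) ^ (p * i)) ((-1 : 𝕜) ^ (i * j))]
    abel
  · simp only [Module.End.mul_apply, contrAux_apply, LinearMap.smul_apply, Prod.smul_snd]
    rw [← mul_assoc, hc, smul_mul_assoc, mul_assoc]

/-- Auxiliary to `contr`: the action of `S W` on `S W × S W`. -/
def contrHom (τ : W →ₗ[𝕜] W) (p : ℕ) (φ : Module.Dual 𝕜 W) :
    Sym τ →ₐ[𝕜] Module.End 𝕜 (Sym τ × Sym τ) :=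
  lift τ (contrAux τ p φ) (contrAux_comm τ p φ)

/-- The left partial derivative of parity `p` in the direction of the covector `φ_p`: the linear
map with `∂ 1 = 0` and `∂ (w s) = φ_p(w) s + (-1)^{p|w|} w ∂ s`, see `contr_one`, `contr_gen_mul`. -/
def contr (τ : W →ₗ[𝕜] W) (p : ℕ) (φ : Module.Dual 𝕜 W) : Sym τ →ₗ[𝕜] Sym τ where
  toFun s := (contrHom τ p φ s (0, 1)).1
  map_add' a b := by simp
  map_smul' a b := by simp

theorem contrHom_snd (τ : W →ₗ[𝕜] W) (p : ℕ) (φ : Module.Dual 𝕜 W) (k : ℕ) (s : Sym τ)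
    (hs : s ∈ weight τ k) : (contrHom τ p φ s (0, 1)).2 = s := by
  induction hs using Submodule.pow_induction_on_left' with
  | algebraMap r => simp [Algebra.algebraMap_eq_smul_one]
  | add x y i hx hy ihx ihy => simp [ihx, ihy]
  | mem_mul m hm i x hx ih =>
    obtain ⟨w, rfl⟩ := hm
    rw [map_mul, Module.End.mul_apply, contrHom, lift_gen, contrAux_apply, ← contrHom, ih]

theorem contr_one (τ : W →ₗ[𝕜] W) (p : ℕ) (φ : Module.Dual 𝕜 W) : contr τ p φ 1 = 0 := by
  simp [contr]

theorem contr_gen_mul (τ : W →ₗ[𝕜] W) (p : ℕ) (φ : Module.Dual 𝕜 W) (w : W) (k : ℕ) (s : Sym τ)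
    (hs : s ∈ weight τ k) :
    contr τ p φ (gen τ w * s) =
      covParity τ p φ w • s + gen τ ((τ ^ p) w) * contr τ p φ s := by
  change (contrHom τ p φ (gen τ w * s) (0, 1)).1 = _
  rw [map_mul, Module.End.mul_apply, contrHom, lift_gen, contrAux_apply, ← contrHom,
    contrHom_snd τ p φ k s hs, add_comm]
  rfl

theorem contr_mem' (τ : W →ₗ[𝕜] W) (p : ℕ) (φ : Module.Dual 𝕜 W) (k : ℕ) (s : Sym τ)
    (hs : s ∈ weight τ k) : (k = 0 → contr τ p φ s = 0) ∧ contr τ p φ s ∈ weight τ (k - 1) := by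
  induction hs using Submodule.pow_induction_on_left' with
  | algebraMap r => simp [Algebra.algebraMap_eq_smul_one, contr_one]
  | add x y i hx hy ihx ihy =>
    rw [map_add]
    exact ⟨fun h => by rw [ihx.1 h, ihy.1 h, add_zero], add_mem ihx.2 ihy.2⟩
  | mem_mul m hm i x hx ih =>
    obtain ⟨w, rfl⟩ := hm
    refine ⟨fun h => by omega, ?_⟩
    rw [contr_gen_mul τ p φ w i x hx]
    refine add_mem (Submodule.smul_mem _ _ hx) ?_
    rcases i with _ | i
    · rw [ih.1 rfl, mul_zero]
      exact zero_mem _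
    · have := Submodule.mul_mem_mul (LinearMap.mem_range_self (gen τ) ((τ ^ p) w)) ih.2
      simpa [weight, pow_succ'] using this

theorem contr_mem (τ : W →ₗ[𝕜] W) (p : ℕ) (φ : Module.Dual 𝕜 W) (k : ℕ) (s : Sym τ)
    (hs : s ∈ weight τ (k + 1)) : contr τ p φ s ∈ weight τ k :=
  (contr_mem' τ p φ (k + 1) s hs).2

end Sym

/-! ## Complete graded symmetric algebras -/

section CSym

variable {𝕜 : Type*} [Field 𝕜] {W : Type*} [AddCommGroup W] [Module 𝕜 W]
  {V : Type*} [AddCommGroup V] [Module 𝕜 V]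

/-- The complete graded symmetric algebra `Ŝ W = ∏_k S^k W`. Its part of degree `i` is `cdeg τ 𝒲 i`
below; all operations are defined on the whole product and respect the degrees. -/
def CSym (τ : W →ₗ[𝕜] W) : Type _ := (k : ℕ) → weight τ k

instance (τ : W →ₗ[𝕜] W) : AddCommGroup (CSym τ) :=
  inferInstanceAs (AddCommGroup ((k : ℕ) → weight τ k))

instance (τ : W →ₗ[𝕜] W) : Module 𝕜 (CSym τ) :=
  inferInstanceAs (Module 𝕜 ((k : ℕ) → weight τ k))

/-- The element of `Ŝ W` with given components. -/
def CSym.of {τ : W →ₗ[𝕜] W} (u : (k : ℕ) → weight τ k) : CSym τ := u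

@[simp] theorem CSym.of_apply {τ : W →ₗ[𝕜] W} (u : (k : ℕ) → weight τ k) (k : ℕ) :
    CSym.of u k = u k := rfl

theorem CSym.ext {τ : W →ₗ[𝕜] W} {f g : CSym τ} (h : ∀ k, (f k : Sym τ) = g k) : f = g :=
  funext fun k => Subtype.ext (h k)

@[simp] theorem CSym.add_apply {τ : W →ₗ[𝕜] W} (f g : CSym τ) (k : ℕ) :
    (f + g) k = f k + g k := rfl

@[simp] theorem CSym.sub_apply {τ : W →ₗ[𝕜] W} (f g : CSym τ) (k : ℕ) :
    (f - g) k = f k - g k := rfl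

@[simp] theorem CSym.smul_apply {τ : W →ₗ[𝕜] W} (c : 𝕜) (f : CSym τ) (k : ℕ) :
    (c • f) k = c • f k := rfl

@[simp] theorem CSym.zero_apply {τ : W →ₗ[𝕜] W} (k : ℕ) : (0 : CSym τ) k = 0 := rfl

/-- The product of `Ŝ W`. -/
def mul (τ : W →ₗ[𝕜] W) : CSym τ →ₗ[𝕜] CSym τ →ₗ[𝕜] CSym τ :=
  LinearMap.mk₂ 𝕜
    (fun f g => CSym.of fun N => ⟨∑ q ∈ Finset.HasAntidiagonal.antidiagonal N, (f q.1 : Sym τ) * (g q.2 : Sym τ),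
      Submodule.sum_mem _ fun q hq => by
        rw [← Finset.HasAntidiagonal.mem_antidiagonal.1 hq, weight, pow_add]
        exact Submodule.mul_mem_mul (f q.1).2 (g q.2).2⟩)
    (by intros; apply CSym.ext; simp [add_mul, Finset.sum_add_distrib])
    (by intros; apply CSym.ext; simp [Finset.smul_sum])
    (by intros; apply CSym.ext; simp [mul_add, Finset.sum_add_distrib])
    (by intros; apply CSym.ext; simp [Finset.smul_sum])

/-- The inclusion of the generators `W → Ŝ W`. -/
def cgen (τ : W →ₗ[𝕜] W) : W →ₗ[𝕜] CSym τ where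
  toFun w := CSym.of fun k => if h : k = 1 then ⟨gen τ w, by rw [h, weight, pow_one]; exact ⟨w, rfl⟩⟩ else 0
  map_add' v w := by
    apply CSym.ext; intro k; by_cases h : k = 1 <;> simp [h]
  map_smul' c w := by
    apply CSym.ext; intro k; by_cases h : k = 1 <;> simp [h]

/-- Functoriality of `Ŝ`. -/
def cmap (τ : W →ₗ[𝕜] W) (τ' : V →ₗ[𝕜] V) (g : W →ₗ[𝕜] V) (hg : g ∘ₗ τ = τ' ∘ₗ g) :
    CSym τ →ₗ[𝕜] CSym τ' where
  toFun f := CSym.of fun k => ⟨symMap τ τ' g hg (f k), symMap_mem τ τ' g hg k _ (f k).2⟩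
  map_add' f f' := by apply CSym.ext; simp
  map_smul' c f := by apply CSym.ext; simp

/-- The parity operator of `Ŝ W`, `f ↦ (-1)^|f| f`. -/
def cparity (τ : W →ₗ[𝕜] W) : CSym τ →ₗ[𝕜] CSym τ := cmap τ τ τ rfl

/-- `ccontr τ p φ` is the continuous extension of `contr τ p φ` to `Ŝ W`. -/
def ccontr (τ : W →ₗ[𝕜] W) (p : ℕ) (φ : Module.Dual 𝕜 W) : CSym τ →ₗ[𝕜] CSym τ where
  toFun f := CSym.of fun k => ⟨contr τ p φ (f (k + 1)), contr_mem τ p φ k _ (f (k + 1)).2⟩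
  map_add' f f' := by apply CSym.ext; simp
  map_smul' c f := by apply CSym.ext; simp

/-- The left partial derivative along `φ`: `∂(w s) = φ(w) s + (-1)^{|φ||w|} w ∂ s`. -/
def leftD (τ : W →ₗ[𝕜] W) (φ : Module.Dual 𝕜 W) : CSym τ →ₗ[𝕜] CSym τ :=
  ccontr τ 0 φ + ccontr τ 1 φ

/-- The right partial derivative along `φ`: `∂(s w) = s φ(w) + (-1)^{|φ||w|} (∂ s) w`; on `f` it is
`(-1)^{|φ|(|f| - |φ|)}` times the left one. -/
def rightD (τ : W →ₗ[𝕜] W) (φ : Module.Dual 𝕜 W) : CSym τ →ₗ[𝕜] CSym τ :=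
  ccontr τ 0 φ + cparity τ ∘ₗ ccontr τ 1 φ

/-- The part of `S W` of degree `i`, for a grading `𝒲` of `W`: it is spanned by the products
`w₁ ⋯ w_l` of homogeneous `w_j ∈ 𝒲 (d_j)` with `d₁ + ⋯ + d_l = i`. -/
def symDeg (τ : W →ₗ[𝕜] W) (𝒲 : ℤ → Submodule 𝕜 W) (i : ℤ) : Submodule 𝕜 (Sym τ) :=
  Submodule.span 𝕜 {s | ∃ l : List (ℤ × W), (∀ a ∈ l, a.2 ∈ 𝒲 a.1) ∧
    (l.map Prod.fst).sum = i ∧ s = (l.map fun a => gen τ a.2).prod}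

/-- The part of `Ŝ W` of degree `i`. -/
def cdeg (τ : W →ₗ[𝕜] W) (𝒲 : ℤ → Submodule 𝕜 W) (i : ℤ) : Submodule 𝕜 (CSym τ) where
  carrier := {f | ∀ k, (f k : Sym τ) ∈ symDeg τ 𝒲 i}
  add_mem' ha hb k := add_mem (ha k) (hb k)
  zero_mem' _ := zero_mem _
  smul_mem' c _ ha k := Submodule.smul_mem _ c (ha k)

/-- The sign `(-1)^k` for an integer `k`, as a scalar. -/
def sgn (𝕜 : Type*) [Field 𝕜] (k : ℤ) : 𝕜 := ((k.negOnePow : ℤˣ) : ℤ)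

theorem sgn_add (k l : ℤ) : sgn 𝕜 (k + l) = sgn 𝕜 k * sgn 𝕜 l := by
  simp [sgn, Int.negOnePow_add]

theorem sgn_mul_self (k : ℤ) : sgn 𝕜 k * sgn 𝕜 k = 1 := by
  rw [← sgn_add, sgn, ← two_mul]
  simp

/-- Continuous derivations `Q` of `Ŝ W` of degree `p` (`Q(fg) = Q(f) g + (-1)^{p|f|} f Q(g)`)
vanishing at zero: no value of `Q` has a constant term. -/
def derBar (τ : W →ₗ[𝕜] W) (𝒲 : ℤ → Submodule 𝕜 W) (p : ℤ) :
    Submodule 𝕜 (Module.End 𝕜 (CSym τ)) where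
  carrier := {Q | (∀ i, ∀ f ∈ cdeg τ 𝒲 i, Q f ∈ cdeg τ 𝒲 (i + p)) ∧
    (∀ i, ∀ f ∈ cdeg τ 𝒲 i, ∀ g, Q (mul τ f g) = mul τ (Q f) g + sgn 𝕜 (p * i) • mul τ f (Q g)) ∧
    (∀ N, ∃ K, ∀ f : CSym τ, (∀ k < K, f k = 0) → ∀ k < N, Q f k = 0) ∧
    (∀ f, Q f 0 = 0)}
  add_mem' := by
    rintro a b ⟨a1, a2, a3, a4⟩ ⟨b1, b2, b3, b4⟩
    refine ⟨fun i f hf => add_mem (a1 i f hf) (b1 i f hf), fun i f hf g => ?_, fun N => ?_,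
      fun f => ?_⟩
    · simp only [LinearMap.add_apply, a2 i f hf, b2 i f hf, map_add, smul_add]
      abel
    · obtain ⟨K, hK⟩ := a3 N
      obtain ⟨L, hL⟩ := b3 N
      refine ⟨max K L, fun f hf k hk => ?_⟩
      simp [hK f (fun j hj => hf j (lt_max_of_lt_left hj)) k hk,
        hL f (fun j hj => hf j (lt_max_of_lt_right hj)) k hk]
    · simp [a4, b4]
  zero_mem' := by
    refine ⟨fun i f hf => zero_mem _, fun i f hf g => by simp, fun N => ⟨0, by simp⟩, by simp⟩
  smul_mem' := by
    rintro c a ⟨a1, a2, a3, a4⟩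
    refine ⟨fun i f hf => Submodule.smul_mem _ c (a1 i f hf), fun i f hf g => ?_, fun N => ?_,
      fun f => ?_⟩
    · simp only [LinearMap.smul_apply, a2 i f hf, map_smul, smul_add]
      rw [smul_comm]
    · obtain ⟨K, hK⟩ := a3 N
      exact ⟨K, fun f hf k hk => by simp [hK f hf k hk]⟩
    · simp [a4]

/-- The graded commutator of derivations, `[Q, R] = Q R - (-1)^{pq} R Q`. -/
def derComm (τ : W →ₗ[𝕜] W) (𝒲 : ℤ → Submodule 𝕜 W) (p q : ℤ) :
    derBar τ 𝒲 p →ₗ[𝕜] derBar τ 𝒲 q →ₗ[𝕜] derBar τ 𝒲 (p + q) :=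
  LinearMap.mk₂ 𝕜
    (fun Q R => ⟨Q.1 * R.1 - sgn 𝕜 (p * q) • (R.1 * Q.1), by
      obtain ⟨Q, a1, a2, a3, a4⟩ := Q
      obtain ⟨R, b1, b2, b3, b4⟩ := R
      refine ⟨fun i f hf => ?_, fun i f hf g => ?_, fun N => ?_, fun f => ?_⟩
      · refine sub_mem ?_ (Submodule.smul_mem _ _ ?_)
        · have := a1 _ _ (b1 i f hf)
          rwa [show i + q + p = i + (p + q) by ring] at this
        · have := b1 _ _ (a1 i f hf)
          rwa [show i + p + q = i + (p + q) by ring] at this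
      · simp only [LinearMap.sub_apply, LinearMap.smul_apply, Module.End.mul_apply, a2 i f hf,
          b2 i f hf, map_add, map_smul, a2 _ _ (b1 i f hf), b2 _ _ (a1 i f hf), map_sub,
          smul_add, smul_sub, mul_add, add_mul, sgn_add, smul_smul]
        simp only [mul_comm q p]
        have h2 := sgn_mul_self (𝕜 := 𝕜) (p * q)
        simp only [← mul_assoc, h2, one_mul, mul_comm] at *
        match_scalars <;> ring
      · obtain ⟨K, hK⟩ := a3 N
        obtain ⟨K', hK'⟩ := b3 K
        obtain ⟨L, hL⟩ := b3 N
        obtain ⟨L', hL'⟩ := a3 L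
        refine ⟨max K' L', fun f hf k hk => ?_⟩
        simp [hK _ (hK' f fun j hj => hf j (lt_max_of_lt_left hj)) k hk,
          hL _ (hL' f fun j hj => hf j (lt_max_of_lt_right hj)) k hk]
      · simp [a4, b4]⟩)
    (by intros; ext1; simp [add_mul, mul_add]; abel)
    (by intros; ext1; simp [smul_sub]; rw [smul_comm])
    (by intros; ext1; simp [add_mul, mul_add]; abel)
    (by intros; ext1; simp [smul_sub]; rw [smul_comm])

end CSym

/-! ## Series in filtered spaces -/

section Series

variable {𝕜 : Type*} [Field 𝕜] {M : Type*} [AddCommGroup M] [Module 𝕜 M]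

/-- The series `∑_k u k` converges to `s` with respect to the descending filtration `F`. -/
def SumsTo (F : ℕ → Submodule 𝕜 M) (u : ℕ → M) (s : M) : Prop :=
  ∀ N, ∃ K₀, ∀ K, K₀ ≤ K → ∑ k ∈ Finset.range K, u k - s ∈ F N

/-- Maurer-Cartan elements for a system of brackets `br k` (`k ≥ 0`) on a space `M` (which plays
the role of `𝔩[1]`), with `M⁰` the part of degree zero and `F` the filtration giving the topology:
`ξ` has degree zero and `∑_k br k (ξ, …, ξ) / k!` converges to zero. -/
def IsMaurerCartan (br : (k : ℕ) → (Fin k → M) → M) (M0 : Submodule 𝕜 M)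
    (F : ℕ → Submodule 𝕜 M) (ξ : M) : Prop :=
  ξ ∈ M0 ∧ SumsTo F (fun k => ((k.factorial : 𝕜))⁻¹ • br k fun _ => ξ) 0

end Series

/-! ## The spaces attached to a finite-dimensional graded vector space `𝔤` -/

section Main

variable {𝕜 : Type*} [Field 𝕜] {𝔤 : Type*} [AddCommGroup 𝔤] [Module 𝕜 𝔤]
  (𝒢 : ℤ → Submodule 𝕜 𝔤) [DirectSum.Decomposition 𝒢] (n : ℤ)

/-- `v ↦ (-1)^i v` for `v ∈ 𝔤^i`. -/
def par : 𝔤 →ₗ[𝕜] 𝔤 :=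
  DirectSum.toModule 𝕜 ℤ 𝔤 (fun i => sgn 𝕜 i • (𝒢 i).subtype) ∘ₗ
    (DirectSum.decomposeLinearEquiv 𝒢).toLinearMap

/-- The parity operator of `𝔤*[-1]`. -/
def parX : Module.Dual 𝕜 𝔤 →ₗ[𝕜] Module.Dual 𝕜 𝔤 := -(par 𝒢).dualMap

/-- The parity operator of `𝔤[1-n]`. -/
def parY : 𝔤 →ₗ[𝕜] 𝔤 := sgn 𝕜 (n - 1) • par 𝒢

/-- The parity operator of `𝔤*[-1] ⊕ 𝔤[1-n]`. -/
def parW : (Module.Dual 𝕜 𝔤 × 𝔤) →ₗ[𝕜] (Module.Dual 𝕜 𝔤 × 𝔤) := (parX 𝒢).prodMap (parY 𝒢 n)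

/-- The grading of `𝔤*[-1]`: `(𝔤*[-1])^j = (𝔤^{1-j})*`. -/
def degX (j : ℤ) : Submodule 𝕜 (Module.Dual 𝕜 𝔤) where
  carrier := {α | ∀ i, i ≠ 1 - j → ∀ v ∈ 𝒢 i, α v = 0}
  add_mem' ha hb i hi v hv := by simp [ha i hi v hv, hb i hi v hv]
  zero_mem' _ _ _ _ := rfl
  smul_mem' c _ ha i hi v hv := by simp [ha i hi v hv]

/-- The grading of `𝔤[1-n]`: `(𝔤[1-n])^j = 𝔤^{j+1-n}`. -/
def degY (j : ℤ) : Submodule 𝕜 𝔤 := 𝒢 (j + 1 - n)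

/-- `Ŝ(𝔤*[-1])`. -/
abbrev SX : Type _ := CSym (parX 𝒢)

/-- `Ŝ(𝔤[1-n])`. -/
abbrev SY : Type _ := CSym (parY 𝒢 n)

/-- `L = Ŝ(𝔤*[-1] ⊕ 𝔤[1-n])`; its shift `L[n]` is a graded Lie algebra, see `poisson`. -/
abbrev L : Type _ := CSym (parW 𝒢 n)

/-- The inclusion `Ŝ(𝔤*[-1]) → L`. -/
def inX : SX 𝒢 →ₗ[𝕜] L 𝒢 n :=
  cmap (parX 𝒢) (parW 𝒢 n) (LinearMap.inl 𝕜 _ _) (by ext <;> simp [parW])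

/-- The inclusion `Ŝ(𝔤[1-n]) → L`. -/
def inY : SY 𝒢 n →ₗ[𝕜] L 𝒢 n :=
  cmap (parY 𝒢 n) (parW 𝒢 n) (LinearMap.inr 𝕜 _ _) (by ext <;> simp [parW])

/-- The projection `L → Ŝ(𝔤[1-n])` killing `𝔤*[-1]`. -/
def prY : L 𝒢 n →ₗ[𝕜] SY 𝒢 n :=
  cmap (parW 𝒢 n) (parY 𝒢 n) (LinearMap.snd 𝕜 _ _) (by ext <;> simp [parW])

/-- `𝔥 = (Ŝ_{≥2} 𝔤[1-n])[n]`. -/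
def H : Submodule 𝕜 (SY 𝒢 n) where
  carrier := {f | f 0 = 0 ∧ f 1 = 0}
  add_mem' ha hb := by simp [ha.1, ha.2, hb.1, hb.2]
  zero_mem' := ⟨rfl, rfl⟩
  smul_mem' c _ ha := by simp [ha.1, ha.2]

/-- The part of degree `j` of `𝔥`; because of the shift, it has degree `j + n` in `Ŝ(𝔤[1-n])`. -/
def degH (j : ℤ) : Submodule 𝕜 (H 𝒢 n) :=
  (cdeg (parY 𝒢 n) (degY 𝒢 n) (j + n)).comap (H 𝒢 n).subtype

/-- The parity operator of `𝔥`, `θ ↦ (-1)^|θ| θ` with `|θ|` the degree in `𝔥`. -/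
def parH : H 𝒢 n →ₗ[𝕜] H 𝒢 n :=
  (sgn 𝕜 n • cparity (parY 𝒢 n)).restrict (by
    rintro f ⟨h0, h1⟩
    constructor <;> simp [cparity, cmap, h0, h1])

/-- The inclusion `𝔥 → L[n]`. -/
def inH : H 𝒢 n →ₗ[𝕜] L 𝒢 n := inY 𝒢 n ∘ₗ (H 𝒢 n).subtype

/-- The projection `P : L[n] → 𝔥`. -/
def P : L 𝒢 n →ₗ[𝕜] H 𝒢 n where
  toFun f := ⟨CSym.of fun k => if k < 2 then 0 else prY 𝒢 n f k, by simp [H]⟩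
  map_add' f g := by
    ext1; apply CSym.ext; intro k; by_cases hk : k < 2 <;> simp [hk, -Order.lt_two_iff, -not_lt]
  map_smul' c f := by
    ext1; apply CSym.ext; intro k; by_cases hk : k < 2 <;> simp [hk, -Order.lt_two_iff, -not_lt]

variable [FiniteDimensional 𝕜 𝔤]

/-- The coordinate on `𝔤*[-1] ⊕ 𝔤[1-n]` dual to the basis vector `e_i` of `𝔤[1-n]`. -/
def coordP (i : Fin (Module.finrank 𝕜 𝔤)) : Module.Dual 𝕜 (Module.Dual 𝕜 𝔤 × 𝔤) :=
  (Module.finBasis 𝕜 𝔤).coord i ∘ₗ LinearMap.snd 𝕜 _ _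

/-- The coordinate on `𝔤*[-1] ⊕ 𝔤[1-n]` dual to the dual basis vector `e^i` of `𝔤*[-1]`. -/
def coordX (i : Fin (Module.finrank 𝕜 𝔤)) : Module.Dual 𝕜 (Module.Dual 𝕜 𝔤 × 𝔤) :=
  Module.Dual.eval 𝕜 𝔤 (Module.finBasis 𝕜 𝔤 i) ∘ₗ LinearMap.fst 𝕜 _ _

/-- The `n`-shifted Poisson bracket on `L`, that is, the graded Lie bracket of `L[n]`. It is the
continuous graded biderivation of degree `-n`,
`{a, bc} = {a, b} c + (-1)^{(|a|-n)|b|} b {a, c}`, `{a, b} = -(-1)^{(|a|-n)(|b|-n)} {b, a}`,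
with `{w, x} = (-1)^{n|x|} ⟨x, w⟩` and `{x, w} = -(-1)^{|x|} ⟨x, w⟩` for `x ∈ 𝔤*[-1]` and
`w ∈ 𝔤[1-n]`, the other brackets of generators being zero. The signs are those for which the shifted
double `D` below is a morphism of graded Lie algebras. -/
def poisson : L 𝒢 n →ₗ[𝕜] L 𝒢 n →ₗ[𝕜] L 𝒢 n :=
  ∑ i, ((mul (parW 𝒢 n)).compl₁₂ (rightD (parW 𝒢 n) (coordP i))
      (leftD (parW 𝒢 n) (coordX i ∘ₗ parW 𝒢 n ^ n.natAbs)) -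
    (mul (parW 𝒢 n)).compl₁₂ (rightD (parW 𝒢 n) (coordX i ∘ₗ parW 𝒢 n))
      (leftD (parW 𝒢 n) (coordP i)))

/-- The right adjoint action `ad_θ x = {x, θ}` of `θ ∈ 𝔥` on `L[n]`. -/
def ad (θ : H 𝒢 n) : L 𝒢 n →ₗ[𝕜] L 𝒢 n := (poisson 𝒢 n).flip (inH 𝒢 n θ)

/-- The part of degree `p` of the graded Lie algebra of continuous derivations of `Ŝ(𝔤*[-1])`
vanishing at zero. -/
abbrev Der (p : ℤ) : Submodule 𝕜 (Module.End 𝕜 (SX 𝒢)) := derBar (parX 𝒢) (degX 𝒢) p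

/-- The `n`-shifted double. A derivation `Q` is identified with `∑ Q(e^i) ⊗ e_i`, and `f ⊗ w` is sent
to `(-1)^{n|f|} f w`. -/
def D : Module.End 𝕜 (SX 𝒢) →ₗ[𝕜] L 𝒢 n where
  toFun Q := ∑ i, mul (parW 𝒢 n)
    (inX 𝒢 n ((cparity (parX 𝒢) ^ n.natAbs)
      (Q (cgen (parX 𝒢) ((Module.finBasis 𝕜 𝔤).coord i)))))
    (cgen (parW 𝒢 n) (0, Module.finBasis 𝕜 𝔤 i))
  map_add' Q R := by simp [Finset.sum_add_distrib]
  map_smul' c Q := by simp [Finset.smul_sum]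

/-! ## Triangular `L_∞`-bialgebras -/

/-- The filtration of `L` by weight. -/
def filL (N : ℕ) : Submodule 𝕜 (L 𝒢 n) where
  carrier := {f | ∀ k < N, f k = 0}
  add_mem' ha hb k hk := by simp [ha k hk, hb k hk]
  zero_mem' _ _ := rfl
  smul_mem' c _ ha k hk := by simp [ha k hk]

/-- An `L_∞`-algebra structure on `𝔤`: a continuous derivation `m` of degree one of `Ŝ(𝔤*[-1])`
without constant term such that `m ∘ m = 0`. -/
def IsLInftyStructure (m : Module.End 𝕜 (SX 𝒢)) : Prop := m ∈ Der 𝒢 1 ∧ m * m = 0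

/-- `y = e^{ad_r} x`, the series `∑_k (ad_r)^k x / k!` being convergent. -/
def IsExpAd (r : H 𝒢 n) (x y : L 𝒢 n) : Prop :=
  SumsTo (filL 𝒢 n) (fun k => ((k.factorial : 𝕜))⁻¹ • (ad 𝒢 n r ^ k) x) y

/-- An `n`-shifted `r_∞`-matrix for `m`: an element `r` of degree zero of `𝔥` such that
`P(e^{ad_r} D(m)) = 0`. -/
def IsRInftyMatrix (m : Module.End 𝕜 (SX 𝒢)) (r : H 𝒢 n) : Prop :=
  r ∈ degH 𝒢 n 0 ∧ ∃ y, IsExpAd 𝒢 n r (D 𝒢 n m) y ∧ P 𝒢 n y = 0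

/-- `(𝔤, m, r)` is a triangular `n`-shifted `L_∞`-bialgebra. -/
def IsTriangular (m : Module.End 𝕜 (SX 𝒢)) (r : H 𝒢 n) : Prop :=
  IsLInftyStructure 𝒢 m ∧ IsRInftyMatrix 𝒢 n m r

/-! ## The `L_∞`-algebra governing triangular `L_∞`-bialgebras -/

/-- The graded vector space of continuous derivations of `Ŝ(𝔤*[-1])` vanishing at zero. -/
abbrev DerBar : Type _ := ⨁ p : ℤ, Der 𝒢 p

/-- The space `𝓛[1] = DerBar[1] ⊕ 𝔥`, where `𝓛 = DerBar ⊕ 𝔥[-1]`. -/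
abbrev LHM : Type _ := DerBar 𝒢 × H 𝒢 n

/-- The part of degree `d` of `𝓛[1]`. -/
def LHM.deg (d : ℤ) : Submodule 𝕜 (LHM 𝒢 n) :=
  (LinearMap.range (DirectSum.lof 𝕜 ℤ (fun p => Der 𝒢 p) (d + 1))).prod (degH 𝒢 n d)

/-- The filtration of `𝓛[1]` by weight: `(Q, θ)` lies in the `N`-th step if neither `θ` nor the
values of the components of `Q` have components of weight less than `N`. -/
def LHM.fil (N : ℕ) : Submodule 𝕜 (LHM 𝒢 n) where
  carrier := {ξ | (∀ p f, ∀ k < N, (ξ.1 p).1 f k = 0) ∧ ∀ k < N, ξ.2.1 k = 0}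
  add_mem' ha hb :=
    ⟨fun p f k hk => by simp [ha.1 p f k hk, hb.1 p f k hk],
      fun k hk => by simp [ha.2 k hk, hb.2 k hk]⟩
  zero_mem' := ⟨fun p f k hk => by simp, fun k hk => by simp⟩
  smul_mem' c _ ha :=
    ⟨fun p f k hk => by simp [DirectSum.smul_apply, ha.1 p f k hk],
      fun k hk => by simp [ha.2 k hk]⟩

/-- `(Q, R) ↦ (-1)^|Q| [Q, R]`. -/
def LHM.derPart : DerBar 𝒢 →ₗ[𝕜] DerBar 𝒢 →ₗ[𝕜] DerBar 𝒢 :=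
  DirectSum.toModule 𝕜 ℤ _ fun p =>
    (DirectSum.toModule 𝕜 ℤ (Der 𝒢 p →ₗ[𝕜] DerBar 𝒢) fun q =>
      ((sgn 𝕜 p • derComm (parX 𝒢) (degX 𝒢) p q).compr₂
        (DirectSum.lof 𝕜 ℤ (fun p => Der 𝒢 p) (p + q))).flip).flip

/-- For derivations `Q` of degree `p`, and elements `θ` of `𝔥` indexed by `Fin k` (of which `θ i` is
not used): `(-1)^{(p-1)(|θ_0| + ⋯ + |θ_{i-1}|)} P {⋯{D(Q), θ_0}, ⋯, θ_{k-1}}`, where `θ_i` is left out.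
The sign is the Koszul sign for moving `Q[1]`, of degree `p - 1`, from position `i` to the front. -/
def LHM.mixed {k : ℕ} (i : Fin k) (θ : Fin k → H 𝒢 n) (p : ℤ) : Der 𝒢 p →ₗ[𝕜] H 𝒢 n :=
  P 𝒢 n ∘ₗ
    (((List.finRange k).filter (· ≠ i)).foldl
      (fun T j => ad 𝒢 n (if j < i then (parH 𝒢 n ^ (p - 1).natAbs) (θ j) else θ j) ∘ₗ T)
      (D 𝒢 n)) ∘ₗ (Der 𝒢 p).subtype

/-- The component of the `k`-ary bracket in `𝔥`: the sum over the position `i` of the argument from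
`DerBar[1]`, all other arguments being taken from `𝔥`. -/
def LHM.hPart {k : ℕ} (ξ : Fin k → LHM 𝒢 n) : H 𝒢 n :=
  ∑ i, DirectSum.toModule 𝕜 ℤ (H 𝒢 n) (LHM.mixed 𝒢 n i fun j => (ξ j).2) (ξ i).1

/-- The brackets of the `L_∞`-algebra `𝓛`, as graded symmetric operations on `𝓛[1]`. They are
`m_2(Q[1], R[1]) = (-1)^|Q| [Q, R][1]` and
`m_k(Q[1], θ_1, …, θ_{k-1}) = P {⋯{D(Q), θ_1}, ⋯, θ_{k-1}}` for `k ≥ 2`; the brackets of other kinds of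
arguments vanish, unless they come from these by a permutation of the arguments. -/
def LHM.bracket : (k : ℕ) → (Fin k → LHM 𝒢 n) → LHM 𝒢 n
  | 0, _ => 0
  | 1, _ => 0
  | 2, ξ => (LHM.derPart 𝒢 (ξ 0).1 (ξ 1).1, LHM.hPart 𝒢 n ξ)
  | _ + 3, ξ => (0, LHM.hPart 𝒢 n ξ)

/-- Maurer-Cartan elements of `𝓛`. -/
def LHM.IsMC (ξ : LHM 𝒢 n) : Prop :=
  IsMaurerCartan (LHM.bracket 𝒢 n) (LHM.deg 𝒢 n 0) (LHM.fil 𝒢 n) ξ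

/-- The element `(m[1], r)` of `𝓛[1]`, for a derivation `m` of degree one. -/
def LHM.mk (m : Der 𝒢 1) (r : H 𝒢 n) : LHM 𝒢 n :=
  (DirectSum.lof 𝕜 ℤ (fun p => Der 𝒢 p) 1 m, r)

end Main

end TriangularLInfty

end

/-!
For `ξ = (m[1], r)` the `k`-ary bracket `m_k(ξ, …, ξ)` has at most two components. The component in
derivations occurs only for `k = 2`, where it is `-2 m²`, because `m` is odd. In the component in
`𝔥`, each of the `k` positions of `m[1]` contributes `P (ad_r^{k-1} D(m))`, without sign since `m[1]`
has degree zero; as `k / k! = 1 / (k-1)!`, the Maurer-Cartan series has the components `-m²` and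
`∑_{k ≥ 1} P (ad_r^k D(m)) / k!`. The missing term `P (D(m))` vanishes, since `m` has no constant
term and so every monomial of `D(m)` contains a generator from `𝔤*[-1]` (`P_D_eq_zero`).

What is left is the convergence of `e^{ad_r} D(m)` in `L` itself and not only after projecting to
`𝔥`. As `r` has weight at least two and involves only generators from `𝔤[1-n]`, the operator `ad_r`
replaces a generator from `𝔤*[-1]` by at least one generator from `𝔤[1-n]`, and hence raises the
degree in `𝔤[1-n]` (`ad_mem_filY`). In weight `N` this degree is at most `N`, so the component of
weight `N` of the series is a finite sum (`exists_isExpAd`).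
-/

noncomputable section

namespace TriangularLInfty

/-! ### The filtration by the number of generators from a subspace -/

section Filtration

variable {𝕜 : Type*} [Field 𝕜] {W : Type*} [AddCommGroup W] [Module 𝕜 W]
  (τ : W →ₗ[𝕜] W) (U : Submodule 𝕜 W)

/-- The span in `S^k W` of the products of `k` generators at least `j` of which lie in `U`. -/
def genFil : ℕ → ℕ → Submodule 𝕜 (Sym τ)
  | 0, 0 => 1
  | 0, _ + 1 => ⊥
  | k + 1, 0 => LinearMap.range (gen τ) * genFil k 0
  | k + 1, j + 1 => LinearMap.range (gen τ) * genFil k (j + 1) ⊔ U.map (gen τ) * genFil k j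

theorem genFil_zero_right (k : ℕ) : genFil τ U k 0 = weight τ k := by
  induction k with
  | zero => simp [genFil, weight]
  | succ k ih => rw [genFil, ih, weight, weight, pow_succ']

theorem range_mul_genFil_le (k j : ℕ) :
    LinearMap.range (gen τ) * genFil τ U k j ≤ genFil τ U (k + 1) j := by
  cases j with
  | zero => rw [genFil]
  | succ j => rw [genFil]; exact le_sup_left

theorem map_mul_genFil_le (k j : ℕ) :
    U.map (gen τ) * genFil τ U k j ≤ genFil τ U (k + 1) (j + 1) := by
  rw [genFil]; exact le_sup_right

theorem gen_mul_mem_genFil {k j : ℕ} (w : W) {s : Sym τ} (hs : s ∈ genFil τ U k j) :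
    gen τ w * s ∈ genFil τ U (k + 1) j :=
  range_mul_genFil_le τ U k j (Submodule.mul_mem_mul ⟨w, rfl⟩ hs)

theorem gen_mul_mem_genFil_succ {k j : ℕ} {w : W} (hw : w ∈ U) {s : Sym τ}
    (hs : s ∈ genFil τ U k j) : gen τ w * s ∈ genFil τ U (k + 1) (j + 1) :=
  map_mul_genFil_le τ U k j (Submodule.mul_mem_mul ⟨w, hw, rfl⟩ hs)

theorem genFil_eq_bot {k j : ℕ} (h : k < j) : genFil τ U k j = ⊥ := by
  induction k generalizing j with
  | zero =>
    obtain ⟨j, rfl⟩ : ∃ i, j = i + 1 := ⟨j - 1, by omega⟩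
    rfl
  | succ k ih =>
    obtain ⟨j, rfl⟩ : ∃ i, j = i + 1 := ⟨j - 1, by omega⟩
    rw [genFil, ih (show k < j + 1 by omega), ih (show k < j by omega)]
    simp

/-- Induction principle for `genFil`: elements are built from `1` by multiplying on the left with
arbitrary generators, or with generators from `U`, which raise the index `j`. -/
theorem genFil_induction {C : ℕ → ℕ → Sym τ → Prop}
    (one : C 0 0 1)
    (zero : ∀ k j, C k j 0)
    (smul : ∀ k j (c : 𝕜) s, C k j s → C k j (c • s))
    (add : ∀ k j s t, C k j s → C k j t → C k j (s + t))
    (gen_mul : ∀ k j w s, s ∈ genFil τ U k j → C k j s → C (k + 1) j (gen τ w * s))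
    (gen_mul_succ : ∀ k j w s, w ∈ U → s ∈ genFil τ U k j → C k j s →
      C (k + 1) (j + 1) (gen τ w * s))
    {k j : ℕ} {s : Sym τ} (hs : s ∈ genFil τ U k j) : C k j s := by
  induction k generalizing j s with
  | zero =>
    cases j with
    | zero =>
      obtain ⟨c, rfl⟩ := Submodule.mem_one.1 hs
      rw [Algebra.algebraMap_eq_smul_one]
      exact smul _ _ _ _ one
    | succ j =>
      obtain rfl : s = 0 := hs
      exact zero _ _
  | succ k ih =>
    have h1 : ∀ j, ∀ t ∈ LinearMap.range (gen τ) * genFil τ U k j, C (k + 1) j t := by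
      intro j t ht
      induction ht using Submodule.mul_induction_on' with
      | mem_mul_mem a ha b hb =>
        obtain ⟨w, rfl⟩ := ha
        exact gen_mul _ _ _ _ hb (ih hb)
      | add a _ b _ iha ihb => exact add _ _ _ _ iha ihb
    cases j with
    | zero => exact h1 0 s hs
    | succ j =>
      obtain ⟨a, ha, b, hb, rfl⟩ := Submodule.mem_sup.1 hs
      refine add _ _ _ _ (h1 _ a ha) ?_
      clear hs
      induction hb using Submodule.mul_induction_on' with
      | mem_mul_mem a ha b hb =>
        obtain ⟨w, hw, rfl⟩ := ha
        exact gen_mul_succ _ _ _ _ hw hb (ih hb)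
      | add a _ b _ iha ihb => exact add _ _ _ _ iha ihb

theorem genFil_succ_le (k j : ℕ) : genFil τ U k (j + 1) ≤ genFil τ U k j := by
  induction k generalizing j with
  | zero => exact bot_le
  | succ k ih =>
    rw [genFil]
    refine sup_le ((mul_le_mul_right (ih j) _).trans (range_mul_genFil_le τ U k j)) ?_
    exact (mul_le_mul_left LinearMap.map_le_range _).trans (range_mul_genFil_le τ U k j)

theorem genFil_antitone (k : ℕ) : Antitone (genFil τ U k) :=
  antitone_nat_of_succ_le (genFil_succ_le τ U k)

theorem genFil_le_weight (k j : ℕ) : genFil τ U k j ≤ weight τ k :=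
  (genFil_antitone τ U k (Nat.zero_le j)).trans (genFil_zero_right τ U k).le

theorem mul_mem_genFil {k j l i : ℕ} {s t : Sym τ} (hs : s ∈ genFil τ U k j)
    (ht : t ∈ genFil τ U l i) : s * t ∈ genFil τ U (k + l) (j + i) := by
  refine genFil_induction τ U (C := fun k j s => s * t ∈ genFil τ U (k + l) (j + i))
    ?_ ?_ ?_ ?_ ?_ ?_ hs
  · simpa using ht
  · simp
  · intro k j c s h
    rw [smul_mul_assoc]
    exact Submodule.smul_mem _ _ h
  · intro k j s s' h h'
    rw [add_mul]
    exact add_mem h h'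
  · intro k j w s _ h
    rw [mul_assoc, Nat.add_right_comm]
    exact gen_mul_mem_genFil τ U w h
  · intro k j w s hw _ h
    rw [mul_assoc, Nat.add_right_comm k, Nat.add_right_comm j]
    exact gen_mul_mem_genFil_succ τ U hw h

theorem symMap_mem_genFil {V : Type*} [AddCommGroup V] [Module 𝕜 V] (τ' : V →ₗ[𝕜] V)
    (U' : Submodule 𝕜 V) (g : W →ₗ[𝕜] V) (hg : g ∘ₗ τ = τ' ∘ₗ g) (hU : ∀ w ∈ U, g w ∈ U')
    {k j : ℕ} {s : Sym τ} (hs : s ∈ genFil τ U k j) :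
    symMap τ τ' g hg s ∈ genFil τ' U' k j := by
  refine genFil_induction τ U (C := fun k j s => symMap τ τ' g hg s ∈ genFil τ' U' k j)
    ?_ ?_ ?_ ?_ ?_ ?_ hs
  · rw [map_one]
    exact Submodule.one_le.1 le_rfl
  · simp
  · intro k j c s h
    rw [map_smul]
    exact Submodule.smul_mem _ _ h
  · intro k j s s' h h'
    rw [map_add]
    exact add_mem h h'
  · intro k j w s _ h
    rw [map_mul, symMap_gen]
    exact gen_mul_mem_genFil τ' U' _ h
  · intro k j w s hw _ h
    rw [map_mul, symMap_gen]
    exact gen_mul_mem_genFil_succ τ' U' (hU w hw) h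

/-- The case `U = W`: all `k` generators of a monomial of weight `k` lie in `W`. -/
theorem mem_genFil_top {k : ℕ} {s : Sym τ} (hs : s ∈ weight τ k) : s ∈ genFil τ ⊤ k k := by
  induction hs using Submodule.pow_induction_on_left' with
  | algebraMap c => exact Submodule.mem_one.2 ⟨c, rfl⟩
  | add x y i hx hy ihx ihy => exact add_mem ihx ihy
  | mem_mul m hm i x hx ih =>
    obtain ⟨w, rfl⟩ := hm
    exact gen_mul_mem_genFil_succ τ ⊤ trivial ih

theorem pow_apply_mem {U : Submodule 𝕜 W} (hτ : ∀ w ∈ U, τ w ∈ U) (p : ℕ) {w : W} (hw : w ∈ U) :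
    (τ ^ p) w ∈ U := by
  induction p with
  | zero => exact hw
  | succ p ih => rw [pow_succ', Module.End.mul_apply]; exact hτ _ ih

/-- A derivative removes one generator, hence at most one generator from `U`. -/
theorem contr_mem_genFil {U : Submodule 𝕜 W} (hτ : ∀ w ∈ U, τ w ∈ U) (p : ℕ)
    (φ : Module.Dual 𝕜 W) {k j : ℕ} {s : Sym τ} (hs : s ∈ genFil τ U k j) :
    contr τ p φ s ∈ genFil τ U (k - 1) (j - 1) := by
  refine genFil_induction τ U (C := fun k j s => contr τ p φ s ∈ genFil τ U (k - 1) (j - 1))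
    ?_ ?_ ?_ ?_ ?_ ?_ hs
  · simp [contr_one]
  · simp
  · intro k j c s h
    rw [map_smul]
    exact Submodule.smul_mem _ _ h
  · intro k j s s' h h'
    rw [map_add]
    exact add_mem h h'
  · intro k j w s hs h
    rw [contr_gen_mul τ p φ w k s (genFil_le_weight τ U k j hs)]
    refine add_mem (Submodule.smul_mem _ _ (genFil_antitone τ U k (Nat.sub_le j 1) hs)) ?_
    rcases k with _ | k
    · simp [(contr_mem' τ p φ 0 s (genFil_le_weight τ U 0 j hs)).1 rfl]
    · exact gen_mul_mem_genFil τ U _ h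
  · intro k j w s hw hs h
    rw [contr_gen_mul τ p φ w k s (genFil_le_weight τ U k j hs)]
    refine add_mem (Submodule.smul_mem _ _ hs) ?_
    rcases k with _ | k
    · simp [(contr_mem' τ p φ 0 s (genFil_le_weight τ U 0 j hs)).1 rfl]
    rcases j with _ | j
    · exact gen_mul_mem_genFil τ U _ h
    · exact gen_mul_mem_genFil_succ τ U (pow_apply_mem τ hτ p hw) h

/-- A derivative along a covector vanishing on `U` does not remove generators from `U`. -/
theorem contr_mem_genFil_of_eq_zero {U : Submodule 𝕜 W} (hτ : ∀ w ∈ U, τ w ∈ U) (p : ℕ)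
    {φ : Module.Dual 𝕜 W} (hφ : ∀ w ∈ U, φ w = 0) {k j : ℕ} {s : Sym τ}
    (hs : s ∈ genFil τ U k j) : contr τ p φ s ∈ genFil τ U (k - 1) j := by
  refine genFil_induction τ U (C := fun k j s => contr τ p φ s ∈ genFil τ U (k - 1) j)
    ?_ ?_ ?_ ?_ ?_ ?_ hs
  · simp [contr_one]
  · simp
  · intro k j c s h
    rw [map_smul]
    exact Submodule.smul_mem _ _ h
  · intro k j s s' h h'
    rw [map_add]
    exact add_mem h h'
  · intro k j w s hs h
    rw [contr_gen_mul τ p φ w k s (genFil_le_weight τ U k j hs)]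
    refine add_mem (Submodule.smul_mem _ _ hs) ?_
    rcases k with _ | k
    · simp [(contr_mem' τ p φ 0 s (genFil_le_weight τ U 0 j hs)).1 rfl]
    · exact gen_mul_mem_genFil τ U _ h
  · intro k j w s hw hs h
    have h0 : covParity τ p φ w = 0 := by simp [covParity, hφ w hw, hφ _ (hτ w hw)]
    rw [contr_gen_mul τ p φ w k s (genFil_le_weight τ U k j hs), h0, zero_smul, zero_add]
    rcases k with _ | k
    · simp [(contr_mem' τ p φ 0 s (genFil_le_weight τ U 0 j hs)).1 rfl]
    · exact gen_mul_mem_genFil_succ τ U (pow_apply_mem τ hτ p hw) h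

/-- The subspace of `Ŝ W` of series all of whose monomials contain at least `j` generators
from `U`. -/
def cgenFil (j : ℕ) : Submodule 𝕜 (CSym τ) where
  carrier := {f | ∀ k, (f k : Sym τ) ∈ genFil τ U k j}
  add_mem' ha hb k := add_mem (ha k) (hb k)
  zero_mem' _ := zero_mem _
  smul_mem' c _ ha k := Submodule.smul_mem _ c (ha k)

theorem mem_cgenFil_zero (f : CSym τ) : f ∈ cgenFil τ U 0 := fun k => by
  rw [genFil_zero_right]
  exact (f k).2

theorem apply_eq_zero_of_mem_cgenFil {j k : ℕ} {f : CSym τ} (hf : f ∈ cgenFil τ U j)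
    (h : k < j) : f k = 0 := by
  have := hf k
  rw [genFil_eq_bot τ U h] at this
  exact Subtype.ext this

theorem mul_apply_coe (f g : CSym τ) (N : ℕ) : (mul τ f g N : Sym τ) =
    ∑ q ∈ Finset.HasAntidiagonal.antidiagonal N, (f q.1 : Sym τ) * (g q.2 : Sym τ) := rfl

theorem mul_mem_cgenFil {j i : ℕ} {f g : CSym τ} (hf : f ∈ cgenFil τ U j)
    (hg : g ∈ cgenFil τ U i) : mul τ f g ∈ cgenFil τ U (j + i) := fun N => by
  rw [mul_apply_coe]
  refine Submodule.sum_mem _ fun q hq => ?_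
  rw [← Finset.HasAntidiagonal.mem_antidiagonal.1 hq]
  exact mul_mem_genFil τ U (hf q.1) (hg q.2)

theorem cparity_mem_cgenFil {U : Submodule 𝕜 W} (hτ : ∀ w ∈ U, τ w ∈ U) {j : ℕ} {f : CSym τ}
    (hf : f ∈ cgenFil τ U j) : cparity τ f ∈ cgenFil τ U j := fun k =>
  symMap_mem_genFil τ U τ U τ rfl hτ (hf k)

theorem ccontr_mem_cgenFil {U : Submodule 𝕜 W} (hτ : ∀ w ∈ U, τ w ∈ U) (p : ℕ)
    (φ : Module.Dual 𝕜 W) {j : ℕ} {f : CSym τ} (hf : f ∈ cgenFil τ U (j + 1)) :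
    ccontr τ p φ f ∈ cgenFil τ U j := fun k => contr_mem_genFil τ hτ p φ (hf (k + 1))

theorem ccontr_mem_cgenFil_of_eq_zero {U : Submodule 𝕜 W} (hτ : ∀ w ∈ U, τ w ∈ U) (p : ℕ)
    {φ : Module.Dual 𝕜 W} (hφ : ∀ w ∈ U, φ w = 0) {j : ℕ} {f : CSym τ}
    (hf : f ∈ cgenFil τ U j) : ccontr τ p φ f ∈ cgenFil τ U j := fun k =>
  contr_mem_genFil_of_eq_zero τ hτ p hφ (hf (k + 1))

theorem ccontr_eq_zero {U : Submodule 𝕜 W} (hτ : ∀ w ∈ U, τ w ∈ U) (p : ℕ)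
    {φ : Module.Dual 𝕜 W} (hφ : ∀ w ∈ U, φ w = 0) {f : CSym τ}
    (hf : ∀ k, (f k : Sym τ) ∈ genFil τ U k k) : ccontr τ p φ f = 0 := by
  apply CSym.ext
  intro k
  have h := contr_mem_genFil_of_eq_zero τ hτ p hφ (hf (k + 1))
  rw [Nat.add_sub_cancel, genFil_eq_bot τ U (Nat.lt_succ_self k)] at h
  exact h

end Filtration

/-! ### Series and compositions -/

section Series

variable {𝕜 : Type*} [Field 𝕜]

theorem sumsTo_zero_iff {M : Type*} [AddCommGroup M] [Module 𝕜 M] {F : ℕ → Submodule 𝕜 M}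
    {u : ℕ → M} : SumsTo F u 0 ↔ ∀ N, ∃ K₀, ∀ K, K₀ ≤ K → ∑ k ∈ Finset.range K, u k ∈ F N := by
  simp only [SumsTo, sub_zero]

theorem foldl_comp_const {ι M N : Type*} [AddCommGroup M] [Module 𝕜 M] [AddCommGroup N]
    [Module 𝕜 N] (f : Module.End 𝕜 N) (l : List ι) (T : M →ₗ[𝕜] N) :
    l.foldl (fun T _ => f ∘ₗ T) T = (f ^ l.length) ∘ₗ T := by
  induction l generalizing T with
  | nil => rfl
  | cons a l ih => rw [List.foldl_cons, ih, List.length_cons, pow_succ]; rfl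

theorem length_filter_ne_finRange {k : ℕ} (i : Fin (k + 1)) :
    ((List.finRange (k + 1)).filter (· ≠ i)).length = k := by
  have h := List.length_eq_length_filter_add (l := List.finRange (k + 1)) (· ≠ i)
  have h1 : ((List.finRange (k + 1)).filter fun x => !decide (x ≠ i)).length = 1 := by
    have : (fun x : Fin (k + 1) => !decide (x ≠ i)) = (· == i) := by
      funext x
      by_cases hx : x = i <;> simp [hx]
    rw [this, List.filter_beq, List.length_replicate,
      List.count_eq_one_of_mem (List.nodup_finRange _) (List.mem_finRange i)]
  rw [List.length_finRange] at h
  omega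

end Series

/-! ### The projection killing `𝔤*[-1]` and the square of `m` -/

section Components

variable {𝕜 : Type*} [Field 𝕜] {𝔤 : Type*} [AddCommGroup 𝔤] [Module 𝕜 𝔤]
  (𝒢 : ℤ → Submodule 𝕜 𝔤) [DirectSum.Decomposition 𝒢] (n : ℤ)

@[simp] theorem CSym.sum_apply {W : Type*} [AddCommGroup W] [Module 𝕜 W] {τ : W →ₗ[𝕜] W}
    {ι : Type*} (s : Finset ι) (f : ι → CSym τ) (k : ℕ) : (∑ i ∈ s, f i) k = ∑ i ∈ s, f i k :=
  Finset.sum_apply k s f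

theorem cparity_pow_apply_zero {W : Type*} [AddCommGroup W] [Module 𝕜 W] (τ : W →ₗ[𝕜] W) (p : ℕ)
    (f : CSym τ) (hf : f 0 = 0) : (cparity τ ^ p) f 0 = 0 := by
  induction p with
  | zero => exact hf
  | succ p ih =>
    rw [pow_succ', Module.End.mul_apply]
    refine Subtype.ext ?_
    change symMap _ _ _ _ (((cparity τ ^ p) f 0 : weight τ 0) : Sym τ) = 0
    rw [ih]
    simp

theorem P_apply (f : L 𝒢 n) (k : ℕ) :
    (P 𝒢 n f).1 k = if k < 2 then 0 else prY 𝒢 n f k := rfl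

theorem prY_mul (f g : L 𝒢 n) :
    prY 𝒢 n (mul (parW 𝒢 n) f g) = mul (parY 𝒢 n) (prY 𝒢 n f) (prY 𝒢 n g) := by
  apply CSym.ext
  intro k
  change symMap _ _ _ _ (mul (parW 𝒢 n) f g k : Sym (parW 𝒢 n)) = _
  rw [mul_apply_coe, mul_apply_coe, map_sum]
  exact Finset.sum_congr rfl fun q _ => map_mul _ _ _

theorem prY_inX (f : SX 𝒢) (hf : f 0 = 0) : prY 𝒢 n (inX 𝒢 n f) = 0 := by
  apply CSym.ext
  intro k
  obtain rfl | ⟨l, rfl⟩ : k = 0 ∨ ∃ l, k = l + 1 := by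
    cases k
    exacts [Or.inl rfl, Or.inr ⟨_, rfl⟩]
  · change symMap _ _ _ _ (symMap _ _ _ _ (f 0 : Sym (parX 𝒢))) = 0
    rw [hf]
    simp
  · change symMap _ _ _ _ (symMap _ _ _ _ (f (l + 1) : Sym (parX 𝒢))) = 0
    have h : (f (l + 1) : Sym (parX 𝒢)) ∈ LinearMap.range (gen (parX 𝒢)) ^ (l + 1) :=
      (f (l + 1)).2
    rw [pow_succ'] at h
    generalize (f (l + 1) : Sym (parX 𝒢)) = s at h
    induction h using Submodule.mul_induction_on' with
    | mem_mul_mem a ha b hb =>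
      obtain ⟨w, rfl⟩ := ha
      simp [symMap_gen]
    | add a _ b _ iha ihb => rw [map_add, map_add, iha, ihb, add_zero]

theorem LHM.derPart_mk (m : Der 𝒢 1) :
    LHM.derPart 𝒢 (DirectSum.lof 𝕜 ℤ (fun p => Der 𝒢 p) 1 m)
        (DirectSum.lof 𝕜 ℤ (fun p => Der 𝒢 p) 1 m) =
      DirectSum.lof 𝕜 ℤ (fun p => Der 𝒢 p) 2
        (sgn 𝕜 1 • derComm (parX 𝒢) (degX 𝒢) 1 1 m m) := by
  simp only [LHM.derPart, DirectSum.toModule_lof, LinearMap.flip_apply, LinearMap.compr₂_apply,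
    LinearMap.smul_apply]
  rfl

/-- The graded square `-[m, m] = -2 m²` of an odd derivation. -/
theorem coe_smul_derComm_self (m : Der 𝒢 1) :
    ((sgn 𝕜 1 • derComm (parX 𝒢) (degX 𝒢) 1 1 m m : derBar (parX 𝒢) (degX 𝒢) (1 + 1)) :
      Module.End 𝕜 (SX 𝒢)) = -((2 : 𝕜) • (m.1 * m.1)) := by
  have h : sgn 𝕜 1 = -1 := by simp [sgn]
  change sgn 𝕜 1 • (m.1 * m.1 - sgn 𝕜 (1 * 1) • (m.1 * m.1)) = _
  rw [one_mul, h]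
  module

/-- The component in derivations of the Maurer-Cartan series is `-m²`. -/
theorem half_smul_lof_eq_zero_iff [CharZero 𝕜] (m : Der 𝒢 1) :
    (2 : 𝕜)⁻¹ • DirectSum.lof 𝕜 ℤ (fun p => Der 𝒢 p) 2
        (sgn 𝕜 1 • derComm (parX 𝒢) (degX 𝒢) 1 1 m m) = 0 ↔ m.1 * m.1 = 0 := by
  rw [smul_eq_zero_iff_right (inv_ne_zero two_ne_zero)]
  constructor
  · intro h
    have h1 := DirectSum.of_injective (β := fun p : ℤ => Der 𝒢 p) 2 (h.trans (map_zero _).symm)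
    have h2 := congrArg Subtype.val h1
    refine (smul_eq_zero_iff_right (two_ne_zero (α := 𝕜))).1 (neg_eq_zero.1 ?_)
    exact (coe_smul_derComm_self 𝒢 m).symm.trans h2
  · intro h
    have h1 : sgn 𝕜 1 • derComm (parX 𝒢) (degX 𝒢) 1 1 m m = 0 := by
      refine Subtype.ext ((coe_smul_derComm_self 𝒢 m).trans ?_)
      rw [h, smul_zero, neg_zero]
      rfl
    exact (congrArg _ h1).trans (map_zero _)

theorem LHM.mk_mem_deg_zero_iff (m : Der 𝒢 1) (r : H 𝒢 n) :
    LHM.mk 𝒢 n m r ∈ LHM.deg 𝒢 n 0 ↔ r ∈ degH 𝒢 n 0 :=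
  ⟨fun h => h.2, fun h => ⟨⟨m, rfl⟩, h⟩⟩

end Components

/-! ### The adjoint action of `𝔥` and the convergence of its exponential -/

section Adjoint

variable {𝕜 : Type*} [Field 𝕜] {𝔤 : Type*} [AddCommGroup 𝔤] [Module 𝕜 𝔤]
  (𝒢 : ℤ → Submodule 𝕜 𝔤) [DirectSum.Decomposition 𝒢] (n : ℤ)

/-- The summand `𝔤[1-n]` of the space `𝔤*[-1] ⊕ 𝔤[1-n]` of generators of `L`. -/
abbrev genY (𝕜 𝔤 : Type*) [Field 𝕜] [AddCommGroup 𝔤] [Module 𝕜 𝔤] :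
    Submodule 𝕜 (Module.Dual 𝕜 𝔤 × 𝔤) := LinearMap.ker (LinearMap.fst 𝕜 (Module.Dual 𝕜 𝔤) 𝔤)

theorem parW_mem_genY : ∀ w ∈ genY 𝕜 𝔤, parW 𝒢 n w ∈ genY 𝕜 𝔤 := by
  rintro ⟨α, v⟩ h
  obtain rfl : α = 0 := h
  simp [parW]

/-- The filtration of `L` by the degree in `𝔤[1-n]`. -/
abbrev filY (j : ℕ) : Submodule 𝕜 (L 𝒢 n) := cgenFil (parW 𝒢 n) (genY 𝕜 𝔤) j

theorem inH_mem_genFil (θ : H 𝒢 n) (k : ℕ) :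
    (inH 𝒢 n θ k : Sym (parW 𝒢 n)) ∈ genFil (parW 𝒢 n) (genY 𝕜 𝔤) k k :=
  symMap_mem_genFil (parY 𝒢 n) ⊤ (parW 𝒢 n) (genY 𝕜 𝔤) (LinearMap.inr 𝕜 _ _) _
    (fun w _ => by simp) (mem_genFil_top (parY 𝒢 n) (θ.1 k).2)

theorem inH_mem_filY (θ : H 𝒢 n) : inH 𝒢 n θ ∈ filY 𝒢 n 2 := fun k => by
  rcases lt_or_ge k 2 with hk | hk
  · have h : θ.1 k = 0 := by
      interval_cases k
      exacts [θ.2.1, θ.2.2]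
    have h' : (inH 𝒢 n θ k : Sym (parW 𝒢 n)) = 0 := by
      change symMap _ _ _ _ (θ.1 k : Sym (parY 𝒢 n)) = 0
      rw [h]
      simp
    rw [h']
    exact zero_mem _
  · exact genFil_antitone _ _ k hk (inH_mem_genFil 𝒢 n θ k)

variable [FiniteDimensional 𝕜 𝔤]

theorem coordX_genY (i : Fin (Module.finrank 𝕜 𝔤)) : ∀ w ∈ genY 𝕜 𝔤, coordX i w = 0 := by
  rintro ⟨α, v⟩ h
  obtain rfl : α = 0 := h
  simp [coordX]

/-- In `{x, θ}` only the terms differentiating `x` along `𝔤*[-1]` and `θ` along `𝔤[1-n]` survive: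
they keep the degree of `x` in `𝔤[1-n]`, and a derivative of `θ` has degree at least one. -/
theorem ad_mem_filY (θ : H 𝒢 n) {j : ℕ} {x : L 𝒢 n} (hx : x ∈ filY 𝒢 n j) :
    ad 𝒢 n θ x ∈ filY 𝒢 n (j + 1) := by
  have hτ := parW_mem_genY (𝕜 := 𝕜) 𝒢 n
  simp only [ad, poisson, LinearMap.flip_apply, LinearMap.sum_apply, LinearMap.sub_apply,
    LinearMap.compl₁₂_apply]
  refine Submodule.sum_mem _ fun i _ => ?_
  have h1 : ∀ w ∈ genY 𝕜 𝔤, (coordX i ∘ₗ parW 𝒢 n ^ n.natAbs) w = 0 := fun w hw =>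
    coordX_genY i _ (pow_apply_mem _ hτ _ hw)
  have h2 : ∀ w ∈ genY 𝕜 𝔤, (coordX i ∘ₗ parW 𝒢 n) w = 0 := fun w hw =>
    coordX_genY i _ (hτ w hw)
  have h3 : leftD (parW 𝒢 n) (coordX i ∘ₗ parW 𝒢 n ^ n.natAbs) (inH 𝒢 n θ) = 0 := by
    rw [leftD, LinearMap.add_apply, ccontr_eq_zero _ hτ 0 h1 (inH_mem_genFil 𝒢 n θ),
      ccontr_eq_zero _ hτ 1 h1 (inH_mem_genFil 𝒢 n θ), add_zero]
  rw [h3, map_zero, zero_sub]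
  refine neg_mem (mul_mem_cgenFil _ _ ?_ ?_)
  · exact add_mem (ccontr_mem_cgenFil_of_eq_zero _ hτ 0 h2 hx)
      (cparity_mem_cgenFil _ hτ (ccontr_mem_cgenFil_of_eq_zero _ hτ 1 h2 hx))
  · exact add_mem (ccontr_mem_cgenFil _ hτ 0 _ (inH_mem_filY 𝒢 n θ))
      (ccontr_mem_cgenFil _ hτ 1 _ (inH_mem_filY 𝒢 n θ))

theorem ad_pow_mem_filY (θ : H 𝒢 n) (x : L 𝒢 n) (k : ℕ) : (ad 𝒢 n θ ^ k) x ∈ filY 𝒢 n k := by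
  induction k with
  | zero => exact mem_cgenFil_zero _ _ x
  | succ k ih =>
    rw [pow_succ', Module.End.mul_apply]
    exact ad_mem_filY 𝒢 n θ ih

/-- The exponential series of `ad_r` converges: its `k`-th term vanishes in weights below `k`. -/
theorem exists_isExpAd (r : H 𝒢 n) (x : L 𝒢 n) : ∃ y, IsExpAd 𝒢 n r x y := by
  set u : ℕ → L 𝒢 n := fun k => ((k.factorial : 𝕜))⁻¹ • (ad 𝒢 n r ^ k) x with hu
  have h0 : ∀ N k, N < k → u k N = 0 := fun N k hk =>
    apply_eq_zero_of_mem_cgenFil _ _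
      (Submodule.smul_mem _ _ (ad_pow_mem_filY 𝒢 n r x k)) hk
  refine ⟨CSym.of fun N => ∑ k ∈ Finset.range (N + 1), u k N, fun N => ⟨N, fun K hK k hk => ?_⟩⟩
  rw [CSym.sub_apply, CSym.sum_apply, CSym.of_apply, sub_eq_zero]
  refine (Finset.sum_subset (fun i hi => ?_) fun i _ hi => ?_).symm
  · simp only [Finset.mem_range] at hi ⊢
    omega
  · simp only [Finset.mem_range] at hi
    exact h0 k i (by omega)

/-! ### The projection to `𝔥` -/

/-- For a derivation `Q` without constant term, every monomial of `D(Q)` contains a generator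
from `𝔤*[-1]`. -/
theorem P_D_eq_zero {p : ℤ} (Q : Der 𝒢 p) : P 𝒢 n (D 𝒢 n Q.1) = 0 := by
  have h : prY 𝒢 n (D 𝒢 n Q.1) = 0 := by
    change prY 𝒢 n (∑ i, _) = 0
    rw [map_sum]
    refine Finset.sum_eq_zero fun i _ => ?_
    rw [prY_mul, prY_inX _ _ _ (cparity_pow_apply_zero _ _ _ (Q.2.2.2.2 _)), map_zero,
      LinearMap.zero_apply]
  ext1
  apply CSym.ext
  intro k
  rw [P_apply, h]
  simp

/-! ### The Maurer-Cartan series -/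

/-- Since `m[1]` has degree zero, all positions of `m[1]` contribute equally to the bracket. -/
theorem LHM.hPart_mk (m : Der 𝒢 1) (r : H 𝒢 n) (k : ℕ) :
    LHM.hPart 𝒢 n (fun _ : Fin (k + 1) => LHM.mk 𝒢 n m r) =
      ((k + 1 : ℕ) : 𝕜) • P 𝒢 n ((ad 𝒢 n r ^ k) (D 𝒢 n m.1)) := by
  have h : ∀ i : Fin (k + 1), LHM.mixed 𝒢 n i (fun _ => r) 1 m =
      P 𝒢 n ((ad 𝒢 n r ^ k) (D 𝒢 n m.1)) := by
    intro i
    simp only [LHM.mixed, sub_self, Int.natAbs_zero, pow_zero, Module.End.one_apply, ite_self]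
    rw [foldl_comp_const, length_filter_ne_finRange]
    rfl
  simp only [LHM.hPart, LHM.mk, DirectSum.toModule_lof, h, Finset.sum_const, Finset.card_univ,
    Fintype.card_fin, Nat.cast_smul_eq_nsmul]

/-- The `k`-th term of the series `P (e^{ad_r} D(m))`. -/
def expTerm (m : Module.End 𝕜 (SX 𝒢)) (r : H 𝒢 n) (k : ℕ) : H 𝒢 n :=
  P 𝒢 n (((k.factorial : 𝕜))⁻¹ • (ad 𝒢 n r ^ k) (D 𝒢 n m))

/-- The `k`-th term of the Maurer-Cartan series of `(m[1], r)`. -/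
def mcTerm (m : Der 𝒢 1) (r : H 𝒢 n) (k : ℕ) : LHM 𝒢 n :=
  ((k.factorial : 𝕜))⁻¹ • LHM.bracket 𝒢 n k fun _ => LHM.mk 𝒢 n m r

theorem mcTerm_succ_snd [CharZero 𝕜] (m : Der 𝒢 1) (r : H 𝒢 n) (k : ℕ) :
    (mcTerm 𝒢 n m r (k + 1)).2 = expTerm 𝒢 n m.1 r k := by
  rcases k with _ | k
  · -- The unary bracket is zero, in agreement with `P (D(m)) = 0`.
    have h : expTerm 𝒢 n m.1 r 0 = 0 := by
      simp [expTerm, P_D_eq_zero]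
    rw [h]
    simp [mcTerm, LHM.bracket]
  · have h : (LHM.bracket 𝒢 n (k + 2) fun _ => LHM.mk 𝒢 n m r).2 =
        LHM.hPart 𝒢 n fun _ : Fin (k + 2) => LHM.mk 𝒢 n m r := by
      cases k <;> rfl
    rw [mcTerm, Prod.smul_snd, h, LHM.hPart_mk, expTerm, map_smul, smul_smul]
    congr 1
    have h1 : ((k + 1 + 1 : ℕ) : 𝕜) ≠ 0 := Nat.cast_ne_zero.2 (Nat.succ_ne_zero _)
    rw [Nat.factorial_succ (k + 1), Nat.cast_mul, mul_inv, mul_right_comm,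
      inv_mul_cancel₀ h1, one_mul]

theorem sum_mcTerm_snd [CharZero 𝕜] (m : Der 𝒢 1) (r : H 𝒢 n) (K : ℕ) :
    (∑ k ∈ Finset.range (K + 1), mcTerm 𝒢 n m r k).2 =
      ∑ k ∈ Finset.range K, expTerm 𝒢 n m.1 r k := by
  have h0 : (mcTerm 𝒢 n m r 0).2 = 0 := by simp [mcTerm, LHM.bracket]
  rw [Prod.snd_sum, Finset.sum_range_succ', h0, add_zero]
  exact Finset.sum_congr rfl fun k _ => mcTerm_succ_snd 𝒢 n m r k

theorem sum_mcTerm_fst (m : Der 𝒢 1) (r : H 𝒢 n) (K : ℕ) :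
    (∑ k ∈ Finset.range (K + 3), mcTerm 𝒢 n m r k).1 =
      (2 : 𝕜)⁻¹ • DirectSum.lof 𝕜 ℤ (fun p => Der 𝒢 p) 2
        (sgn 𝕜 1 • derComm (parX 𝒢) (degX 𝒢) 1 1 m m) := by
  rw [Prod.fst_sum]
  induction K with
  | zero =>
    rw [← LHM.derPart_mk]
    simp [Finset.sum_range_succ, mcTerm, LHM.bracket, LHM.mk]
  | succ K ih =>
    rw [Nat.add_right_comm, Finset.sum_range_succ, ih]
    simp [mcTerm, LHM.bracket]

/-- The Maurer-Cartan series converges to zero iff both of its components do. -/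
theorem sumsTo_mcTerm_iff [CharZero 𝕜] (m : Der 𝒢 1) (r : H 𝒢 n) :
    SumsTo (LHM.fil 𝒢 n) (mcTerm 𝒢 n m r) 0 ↔ m.1 * m.1 = 0 ∧
      ∀ N, ∃ K₀, ∀ K, K₀ ≤ K → ∀ k < N,
        (∑ i ∈ Finset.range K, expTerm 𝒢 n m.1 r i).1 k = 0 := by
  rw [sumsTo_zero_iff]
  constructor
  · intro h
    constructor
    · rw [← half_smul_lof_eq_zero_iff]
      refine DFinsupp.ext fun p => Subtype.ext (LinearMap.ext fun f => CSym.ext fun k => ?_)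
      obtain ⟨K₀, hK⟩ := h (k + 1)
      have := (hK (K₀ + 3) (by omega)).1 p f k (Nat.lt_succ_self k)
      rw [sum_mcTerm_fst] at this
      exact congrArg Subtype.val this
    · intro N
      obtain ⟨K₀, hK⟩ := h N
      refine ⟨K₀, fun K hK' k hk => ?_⟩
      have := (hK (K + 1) (by omega)).2 k hk
      rwa [sum_mcTerm_snd] at this
  · rintro ⟨hm, h⟩ N
    obtain ⟨K₀, hK⟩ := h N
    refine ⟨K₀ + 3, fun K hK' => ?_⟩
    obtain ⟨K, rfl⟩ : ∃ i, K = i + 3 := ⟨K - 3, by omega⟩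
    refine ⟨fun p f k _ => ?_, fun k hk => ?_⟩
    · rw [sum_mcTerm_fst, (half_smul_lof_eq_zero_iff 𝒢 m).2 hm]
      rfl
    · rw [sum_mcTerm_snd 𝒢 n m r (K + 2)]
      exact hK _ (by omega) k hk

/-- As `P` is continuous, the projected partial sums become those of `P y`. -/
theorem IsExpAd.sum_expTerm_apply {m : Module.End 𝕜 (SX 𝒢)} {r : H 𝒢 n} {y : L 𝒢 n}
    (hy : IsExpAd 𝒢 n r (D 𝒢 n m) y) (N : ℕ) : ∃ K₀, ∀ K, K₀ ≤ K → ∀ k < N,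
      (∑ i ∈ Finset.range K, expTerm 𝒢 n m r i).1 k = (P 𝒢 n y).1 k := by
  obtain ⟨K₀, hK⟩ := hy N
  refine ⟨K₀, fun K hK' k hk => ?_⟩
  have h := hK K hK' k hk
  have h1 : (P 𝒢 n (∑ i ∈ Finset.range K, ((i.factorial : 𝕜))⁻¹ • (ad 𝒢 n r ^ i) (D 𝒢 n m) -
      y)).1 k = 0 := by
    rw [P_apply]
    split_ifs
    · rfl
    · refine Subtype.ext ?_
      change symMap _ _ _ _ (((_ : L 𝒢 n) k : weight (parW 𝒢 n) k) : Sym (parW 𝒢 n)) = 0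
      rw [h]
      simp
  rw [map_sub, map_sum] at h1
  exact sub_eq_zero.1 h1

/-- The `r_∞`-matrix equation in terms of partial sums in `𝔥`. -/
theorem exists_isExpAd_P_eq_zero_iff (m : Module.End 𝕜 (SX 𝒢)) (r : H 𝒢 n) :
    (∃ y, IsExpAd 𝒢 n r (D 𝒢 n m) y ∧ P 𝒢 n y = 0) ↔
      ∀ N, ∃ K₀, ∀ K, K₀ ≤ K → ∀ k < N,
        (∑ i ∈ Finset.range K, expTerm 𝒢 n m r i).1 k = 0 := by
  constructor
  · rintro ⟨y, hy, hP⟩ N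
    obtain ⟨K₀, hK⟩ := hy.sum_expTerm_apply 𝒢 n N
    refine ⟨K₀, fun K hK' k hk => ?_⟩
    rw [hK K hK' k hk, hP]
    rfl
  · intro h
    obtain ⟨y, hy⟩ := exists_isExpAd 𝒢 n r (D 𝒢 n m)
    refine ⟨y, hy, ?_⟩
    ext1
    apply CSym.ext
    intro k
    obtain ⟨K₀, hK⟩ := hy.sum_expTerm_apply 𝒢 n (k + 1)
    obtain ⟨K₁, hK₁⟩ := h (k + 1)
    rw [← hK (max K₀ K₁) (le_max_left _ _) k (Nat.lt_succ_self k),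
      hK₁ (max K₀ K₁) (le_max_right _ _) k (Nat.lt_succ_self k)]
    rfl

end Adjoint

end TriangularLInfty

end

theorem theorem5p9 {𝕜 : Type*} [Field 𝕜] [CharZero 𝕜] {𝔤 : Type*} [AddCommGroup 𝔤] [Module 𝕜 𝔤]
    [FiniteDimensional 𝕜 𝔤] (𝒢 : ℤ → Submodule 𝕜 𝔤) [DirectSum.Decomposition 𝒢] (n : ℤ)
    (m : TriangularLInfty.Der 𝒢 1) (r : TriangularLInfty.H 𝒢 n) :
    TriangularLInfty.IsTriangular 𝒢 n m.1 r ↔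
      TriangularLInfty.LHM.IsMC 𝒢 n (TriangularLInfty.LHM.mk 𝒢 n m r) := by
  have h1 := TriangularLInfty.LHM.mk_mem_deg_zero_iff 𝒢 n m r
  have h2 := TriangularLInfty.sumsTo_mcTerm_iff 𝒢 n m r
  have h3 := TriangularLInfty.exists_isExpAd_P_eq_zero_iff 𝒢 n m.1 r
  rw [← h3] at h2
  constructor
  · rintro ⟨⟨-, hm⟩, hr, hy⟩
    exact ⟨h1.2 hr, h2.2 ⟨hm, hy⟩⟩
  · rintro ⟨hr, hs⟩
    obtain ⟨hm, hy⟩ := h2.1 hs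
    exact ⟨⟨m.2, hm⟩, h1.1 hr, hy⟩
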